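/- Let $k$ be a field, let $\ell,n,m_1,\dots,m_n$ be positive integers, and for $0\le p\le n$ let $S^{\otimes p}=k[z_1^{\pm1},\dots,z_p^{\pm1}]$ be the ring of Laurent polynomials in $p$ variables, so that $S^{\otimes 0}=k$. Given a grading $\Sigma=\{\mathcal B_{\bar i}\}_{\bar i\in\mathbb Z/m}$ of a $k$-algebra $\mathcal B$ by $\mathbb Z/m\mathbb Z$, that is, $\mathcal B=\bigoplus_{\bar i}\mathcal B_{\bar i}$ as a vector space and $\mathcal B_{\bar i}\mathcal B_{\bar j}\subset\mathcal B_{\bar i+\bar j}$, put $L(\mathcal B,\Sigma,z)=\bigoplus_{i\in\mathbb Z}\mathcal B_{\bar i}\otimes z^i\subset\mathcal B\otimes_k k[z^{\pm1}]$. Let $\mathcal L$ be an $n$-step loop algebra based on the matrix algebra $M_\ell(k)$, that is, $\mathcal L=\mathcal L_n$ for algebras $\mathcal L_0=M_\ell(k),\mathcal L_1,\dots,\mathcal L_n$ such that $\mathcal L_p=L(\mathcal L_{p-1},\Sigma_p,z_p)$ for some grading $\Sigma_p$ of $\mathcal L_{p-1}$ by $\mathbb Z/m_p\mathbb Z$ ($1\le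 p\le n$). Thus $\mathcal L_p$ is regarded as a subalgebra of $M_\ell(k)\otimes_k S^{\otimes p}$. Let $$C(\mathcal L)=\{\chi\in\operatorname{End}_k(\mathcal L):\chi(xy)=\chi(x)y=x\chi(y)\text{ for all }x,y\in\mathcal L\}$$ be the centroid of $\mathcal L$. Then $\mathcal L$ is prime (for two-sided ideals $\mathcal I,\mathcal J$ of the $k$-algebra $\mathcal L$, $\mathcal I\mathcal J=0$ implies $\mathcal I=0$ or $\mathcal J=0$), and $\mathcal L$ is an Azumaya algebra over $C(\mathcal L)$ of constant rank $\ell^2$, that is, for every maximal ideal $\mathfrak m$ of $C(\mathcal L)$ the localization $\mathcal L_{\mathfrak m}$ is a free $C(\mathcal L)_{\mathfrak m}$-module of rank $\ell^2$. Moreover there is a homomorphism of $k$-algebras $\iota:C(\mathcal L)\to S^{\otimes n}$ such that $\iota(\chi)\cdot x=\chi(x)$ in $M_\ell(k)\otimes_k S^{\otimes n}$ for all $\chi\in C(\mathcal L)$ and $x\in\mathcal L$, and the extension $S^{\otimes n}/C(\mathcal L)$ given by $\iota$ splits $\mathcal L$: the homomorphism $\iota$ is injective and makes $S^{\otimes n}$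 a faithfully flat $C(\mathcal L)$-module, and $$\mathcal L\otimes_{C(\mathcal L)}S^{\otimes n}\;\simeq\;M_\ell(S^{\otimes n})$$ as $S^{\otimes n}$-algebras. -/

import Mathlib

open scoped TensorProduct

noncomputable section

namespace LoopAlgebra

universe u v

section Generalities

variable (B : Type u) [CommRing B] (A : Type v) [Ring A] [Algebra B A]

/-- The centroid `C_B(A)`: the `B`-linear maps `χ : A → A` such that
`χ (x y) = χ(x) y = x χ(y)` for all `x, y`. -/
def centroid : Subalgebra B (Module.End B A) where
  carrier := {χ | ∀ x y : A, χ (x * y) = χ x * y ∧ χ (x * y) = x * χ y}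
  mul_mem' := by
    intro χ ψ hχ hψ x y
    constructor
    · rw [Module.End.mul_apply, (hψ x y).1, (hχ _ _).1, Module.End.mul_apply]
    · rw [Module.End.mul_apply, (hψ x y).2, (hχ _ _).2, Module.End.mul_apply]
  add_mem' := by
    intro χ ψ hχ hψ x y
    constructor
    · rw [LinearMap.add_apply, (hψ x y).1, (hχ _ _).1, LinearMap.add_apply, add_mul]
    · rw [LinearMap.add_apply, (hψ x y).2, (hχ _ _).2, LinearMap.add_apply, mul_add]
  algebraMap_mem' := by
    intro b x y
    simp [Module.algebraMap_end_apply]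

/-- The centroid of a unital algebra is commutative. -/
instance : CommRing (centroid B A) :=
  { (inferInstance : Ring (centroid B A)) with
    mul_comm := by
      intro χ ψ
      apply Subtype.ext
      apply LinearMap.ext
      intro x
      have h1 : χ.1 (ψ.1 x) = χ.1 x * ψ.1 1 := by
        have := (ψ.2 x 1).2
        rw [mul_one] at this
        rw [this, (χ.2 x _).1]
      have h2 : ψ.1 (χ.1 x) = χ.1 x * ψ.1 1 := by
        have := (ψ.2 (χ.1 x) 1).2
        rwa [mul_one] at this
      exact h1.trans h2.symm }

/-- `A` is an algebra over its centroid through the action `χ • x = χ(x)`. -/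
instance : Algebra (centroid B A) A :=
  Algebra.ofModule (fun χ x y => ((χ.2 x y).1).symm) (fun χ x y => ((χ.2 x y).2).symm)

theorem centroid_smul_def (χ : centroid B A) (x : A) : χ • x = χ.1 x := rfl

variable {B A} in
/-- A two-sided ideal of the `B`-algebra `A`. -/
def IsIdeal (I : Submodule B A) : Prop :=
  ∀ a : A, ∀ x ∈ I, a * x ∈ I ∧ x * a ∈ I

/-- `A` is a prime `B`-algebra: `I J = 0` implies `I = 0` or `J = 0`, for all two-sided ideals
`I`, `J` of `A`. -/
def IsPrimeAlgebra : Prop :=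
  ∀ I J : Submodule B A, IsIdeal I → IsIdeal J → I * J = ⊥ → I = ⊥ ∨ J = ⊥

/-- The `B`-module `A` has constant rank `r`: for every maximal ideal `𝔪` of `B` the localization
`A_𝔪` is a free `B_𝔪`-module of rank `r`. -/
def HasConstantRank (r : ℕ) : Prop :=
  ∀ (𝔪 : Ideal B) [𝔪.IsMaximal],
    Module.Free (Localization.AtPrime 𝔪) (LocalizedModule 𝔪.primeCompl A) ∧
      Module.Finite (Localization.AtPrime 𝔪) (LocalizedModule 𝔪.primeCompl A) ∧
      Module.finrank (Localization.AtPrime 𝔪) (LocalizedModule 𝔪.primeCompl A) = r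

/-- `A` is split, as a matrix algebra of size `ℓ`, by the ring homomorphism `υ : B → B'`: `υ` is
a faithfully flat extension of rings (in particular injective) and `A ⊗_B B'` is isomorphic to
`M_ℓ(B')` as a `B'`-algebra. -/
def IsSplitBy {B' : Type*} [CommRing B'] (υ : B →+* B') (ℓ : ℕ) : Prop :=
  letI : Algebra B B' := υ.toAlgebra
  Function.Injective υ ∧ Module.FaithfullyFlat B B' ∧
    Nonempty (B' ⊗[B] A ≃ₐ[B'] Matrix (Fin ℓ) (Fin ℓ) B')

end Generalities

section Loop

variable (k : Type u) [Field k] (A : Type v) [Ring A] [Algebra k A]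

/-- The ring `S^{⊗n} = k[z₁^{±1}, …, z_n^{±1}]` of Laurent polynomials in `n` variables, as the
group algebra of `ℤⁿ`. -/
abbrev Laurent (n : ℕ) : Type u := AddMonoidAlgebra k (Fin n → ℤ)

/-- The Laurent monomial `z_p ^ i`. -/
def zpow {n : ℕ} (p : Fin n) (i : ℤ) : Laurent k n :=
  AddMonoidAlgebra.single (Pi.single p i) 1

/-- The algebra `A ⊗ S^{⊗n}` (written with the factor `S^{⊗n}` on the left, so that it is an
`S^{⊗n}`-algebra in the usual way). -/
abbrev Untwisted (n : ℕ) : Type _ := Laurent k n ⊗[k] A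

variable {k} in
/-- The family `Γ = (Γ_ī)` of subspaces of the algebra `D` is a `ℤ/m`-grading of the
subspace `L`: `L = ⨁ Γ_ī` (internally) and `Γ_ī Γ_j̄ ⊆ Γ_{ī+j̄}`. -/
structure IsGrading {D : Type*} [Ring D] [Algebra k D] (L : Submodule k D) {m : ℕ}
    (Γ : ZMod m → Submodule k D) : Prop where
  indep : iSupIndep Γ
  iSup_eq : ⨆ i, Γ i = L
  mul_mem : ∀ i j x y, x ∈ Γ i → y ∈ Γ j → x * y ∈ Γ (i + j)

variable {k A} in
/-- The space `⨁_{i ∈ ℤ} Γ_ī ⊗ z_p^i` inside `A ⊗ S^{⊗n}`, where `Γ_ī ⊗ z_p^i` is identified with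
`z_p^i • Γ_ī`. For `Γ` a grading of a subalgebra `L'` of `A ⊗ k[z₁^{±1}, …, z_{p-1}^{±1}]` the
multiplication map `L' ⊗ k[z_p^{±1}] → A ⊗ S^{⊗n}` is injective, and it identifies this space with
the loop algebra `L(L', Γ, z_p)`. -/
def loopSpace {n m : ℕ} (p : Fin n) (Γ : ZMod m → Submodule k (Untwisted k A n)) :
    Submodule k (Untwisted k A n) :=
  ⨆ i : ℤ, (Γ (i : ZMod m)).map (Algebra.lsmul k k (Untwisted k A n) (zpow k p i))

/-- The data defining an `n`-step loop algebra `L(A, Σ₁, …, Σ_n)` based on `A` with moduli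
`m₁, …, m_n`: algebras `L₀ = A, L₁, …, L_n` and, for each `p`, a `ℤ/m_p`-grading `Σ_p` of the
algebra `L_{p-1}` such that `L_p = L(L_{p-1}, Σ_p, z_p)`. All these algebras are realised in
`A ⊗ S^{⊗n}`; the indices `p` start from `0`, so `space p.castSucc` is the algebra before and
`space p.succ` the algebra after adjoining the variable `z p`. -/
structure Tower (n : ℕ) (m : Fin n → ℕ) where
  space : Fin (n + 1) → Submodule k (Untwisted k A n)
  grading : (p : Fin n) → ZMod (m p) → Submodule k (Untwisted k A n)
  space_zero : space 0 =
    LinearMap.range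
      (Algebra.TensorProduct.includeRight : A →ₐ[k] Untwisted k A n).toLinearMap
  isGrading : ∀ p, IsGrading (space p.castSucc) (grading p)
  space_succ : ∀ p, space p.succ = loopSpace p (grading p)

variable {k A}

theorem zpow_zero {n : ℕ} (p : Fin n) : zpow k p 0 = 1 := by
  simp [zpow, AddMonoidAlgebra.one_def]

theorem zpow_add {n : ℕ} (p : Fin n) (i j : ℤ) :
    zpow k p (i + j) = zpow k p i * zpow k p j := by
  simp [zpow, AddMonoidAlgebra.single_mul_single, Pi.single_add]

/-- The unit of a graded unital algebra is homogeneous of degree `0`. -/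
theorem IsGrading.one_mem {D : Type*} [Ring D] [Algebra k D] {L : Submodule k D} {m : ℕ}
    {Γ : ZMod m → Submodule k D} (h : IsGrading L Γ) (h1 : (1 : D) ∈ L) :
    (1 : D) ∈ Γ 0 := by
  classical
  rw [← h.iSup_eq, Submodule.mem_iSup_iff_exists_dfinsupp'] at h1
  obtain ⟨f, hf⟩ := h1
  have hf' : f.sum (fun _ x => (x : D)) = 1 := hf
  -- each homogeneous element is fixed by right multiplication with the degree `0` part of `1`
  have key : ∀ j, ∀ x ∈ Γ j, x * (f 0 : D) = x := by
    intro j x hx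
    have hsum : ∑ i ∈ f.support, x * (f i : D) = x := by
      rw [← Finset.mul_sum]
      have : ∑ i ∈ f.support, (f i : D) = 1 := hf'
      rw [this, mul_one]
    have h0 : x * (f 0 : D) ∈ Γ j := by simpa using h.mul_mem j 0 x _ hx (f 0).2
    have hrest : x - x * (f 0 : D) ∈ ⨆ i, ⨆ (_ : i ≠ j), Γ i := by
      have heq : x - x * (f 0 : D) = ∑ i ∈ f.support.erase 0, x * (f i : D) := by
        by_cases hs : (0 : ZMod m) ∈ f.support
        · rw [sub_eq_iff_eq_add, Finset.sum_erase_add _ _ hs, hsum]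
        · rw [Finset.erase_eq_of_notMem hs, hsum, DFinsupp.notMem_support_iff.1 hs]
          simp
      rw [heq]
      refine Submodule.sum_mem _ fun i hi => ?_
      have hij : j + i ≠ j := fun e => (Finset.mem_erase.1 hi).1 (by simpa using e)
      exact Submodule.mem_iSup_of_mem (j + i)
        (Submodule.mem_iSup_of_mem hij (h.mul_mem j i x _ hx (f i).2))
    have hzero := Submodule.disjoint_def.1 (h.indep j) _ (Submodule.sub_mem _ hx h0) hrest
    exact (sub_eq_zero.1 hzero).symm
  have h10 : (f 0 : D) = 1 := by
    have : (1 : D) * (f 0 : D) = 1 := by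
      conv_lhs => rw [← hf']
      conv_rhs => rw [← hf']
      rw [DFinsupp.sum, Finset.sum_mul]
      exact Finset.sum_congr rfl (fun i _ => key i _ (f i).2)
    rwa [one_mul] at this
  rw [← h10]
  exact (f 0).2

theorem mem_loopSpace_of_mem {n m : ℕ} (p : Fin n) (Γ : ZMod m → Submodule k (Untwisted k A n))
    (i : ℤ) {x : Untwisted k A n} (hx : x ∈ Γ (i : ZMod m)) :
    zpow k p i • x ∈ loopSpace p Γ :=
  Submodule.mem_iSup_of_mem (p := fun i : ℤ => (Γ (i : ZMod m)).map
    (Algebra.lsmul k k (Untwisted k A n) (zpow k p i))) i ⟨x, hx, rfl⟩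

theorem loopSpace_one_mem {n m : ℕ} (p : Fin n) {L : Submodule k (Untwisted k A n)}
    {Γ : ZMod m → Submodule k (Untwisted k A n)} (h : IsGrading L Γ)
    (h1 : (1 : Untwisted k A n) ∈ L) : (1 : Untwisted k A n) ∈ loopSpace p Γ := by
  have := mem_loopSpace_of_mem p Γ 0 (x := 1) (by simpa using h.one_mem h1)
  rwa [zpow_zero, one_smul] at this

theorem loopSpace_mul_mem {n m : ℕ} (p : Fin n) {L : Submodule k (Untwisted k A n)}
    {Γ : ZMod m → Submodule k (Untwisted k A n)} (h : IsGrading L Γ)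
    {x y : Untwisted k A n} (hx : x ∈ loopSpace p Γ) (hy : y ∈ loopSpace p Γ) :
    x * y ∈ loopSpace p Γ := by
  have hle : loopSpace p Γ * loopSpace p Γ ≤ loopSpace p Γ := by
    conv_lhs => unfold loopSpace
    simp only [Submodule.iSup_mul, Submodule.mul_iSup, iSup_le_iff]
    intro j i
    rw [Submodule.mul_le]
    rintro _ ⟨a, ha, rfl⟩ _ ⟨b, hb, rfl⟩
    have := mem_loopSpace_of_mem p Γ (i + j) (x := a * b)
      (by rw [Int.cast_add]; exact h.mul_mem _ _ _ _ ha hb)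
    have e : zpow k p (i + j) • (a * b) = (zpow k p i • a) * (zpow k p j • b) := by
      rw [zpow_add, smul_mul_smul_comm]
    rwa [e] at this
  exact hle (Submodule.mul_mem_mul hx hy)

namespace Tower

variable {n : ℕ} {m : Fin n → ℕ} (T : Tower k A n m)

theorem one_mem (q : Fin (n + 1)) : (1 : Untwisted k A n) ∈ T.space q := by
  induction q using Fin.induction with
  | zero =>
    rw [T.space_zero]
    exact ⟨1, map_one (Algebra.TensorProduct.includeRight : A →ₐ[k] Untwisted k A n)⟩
  | succ p ih =>
    rw [T.space_succ]
    exact loopSpace_one_mem p (T.isGrading p) ih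

theorem mul_mem (q : Fin (n + 1)) {x y : Untwisted k A n} (hx : x ∈ T.space q)
    (hy : y ∈ T.space q) : x * y ∈ T.space q := by
  induction q using Fin.cases with
  | zero =>
    rw [T.space_zero] at *
    obtain ⟨a, rfl⟩ := hx
    obtain ⟨b, rfl⟩ := hy
    exact ⟨a * b, map_mul (Algebra.TensorProduct.includeRight : A →ₐ[k] Untwisted k A n) a b⟩
  | succ p =>
    rw [T.space_succ] at *
    exact loopSpace_mul_mem p (T.isGrading p) hx hy

/-- The `n`-step loop algebra `L = L_n`, a unital subalgebra of `A ⊗ S^{⊗n}`. -/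
def algebra : Subalgebra k (Untwisted k A n) :=
  (T.space (Fin.last n)).toSubalgebra (T.one_mem _) (fun _ _ hx hy => T.mul_mem _ hx hy)

end Tower

end Loop

end LoopAlgebra

end

/-! Put `U = M_ℓ(k) ⊗ S` with `S = S^{⊗n}`. Everything follows from one decomposition: `U` is the
direct sum of the translates `z^a L` over the finitely many exponents `a` with `0 ≤ a_i < m_i`
(`Tower.decomposition`, `Tower.bijective_sum_algebra`). It is proved by induction along the tower
and needs neither roots of unity nor invertibility of the moduli in `k`.

Evaluation at `1` identifies the centroid `C` with the centre of `L`. That centre commutes with `S L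
= U`, so it lies in the centre `S` of `U`. Conversely, the components of a scalar `t ∈ S` in `U = ⨁
z^a L` commute with `L` by uniqueness, so they lie in `C`. Hence `S` is free over `C` on the
monomials `z^a`, one of which is `1` (`bijective_sum_centroid`), and comparing the two
decompositions gives `S ⊗_C L ≃ U ≃ M_ℓ(S)` (`bijective_baseChangeLift`).

The Azumaya property and the rank then descend from `M_ℓ(S)` to `L` (`isAzumaya_of_baseChange`,
`hasConstantRank_of_baseChange`). Primeness is inherited from `M_ℓ(S)`, since `x L y = 0` forces `x
U y = 0`. -/

noncomputable section
namespace LoopAlgebra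

/-! ### Independent families of submodules -/

section Independence

variable {R M ι κ : Type*} [Ring R] [AddCommGroup M] [Module R M]

/-- A refinement of an independent family by independent families is independent. -/
theorem iSupIndep_prod_of_le {E : ι → Submodule R M} (hE : iSupIndep E)
    {G : ι → κ → Submodule R M} (hG : ∀ i, iSupIndep (G i)) (hle : ∀ i c, G i c ≤ E i) :
    iSupIndep fun x : ι × κ => G x.1 x.2 := by
  classical
  rw [iSupIndep_iff_finsetSum_eq_zero_imp_eq_zero] at hE ⊢
  intro s v hv h0
  -- The terms with first index `i` sum to an element of `E i`, so each fibre of the relation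
  -- vanishes separately.
  have hfib : ∀ i ∈ s.image Prod.fst, ∑ x ∈ s with x.1 = i, v x = 0 := by
    refine hE _ _ (fun i _ => Submodule.sum_mem _ fun x hx => ?_) ?_
    · rw [← (Finset.mem_filter.1 hx).2]
      exact hle _ _ (hv x (Finset.mem_filter.1 hx).1)
    · exact (Finset.sum_fiberwise_of_maps_to (g := Prod.fst)
        (fun x hx => Finset.mem_image_of_mem _ hx) v).trans h0
  intro y hy
  have hfin : ∑ d ∈ (s.filter fun x => x.1 = y.1).image Prod.snd, v (y.1, d) = 0 := by
    rw [Finset.sum_image, ← hfib y.1 (Finset.mem_image_of_mem _ hy)]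
    · refine Finset.sum_congr rfl fun x hx => ?_
      rw [← (Finset.mem_filter.1 hx).2]
    · intro x hx z hz hxz
      exact Prod.ext ((Finset.mem_filter.1 hx).2.trans (Finset.mem_filter.1 hz).2.symm) hxz
  have hG' := (iSupIndep_iff_finsetSum_eq_zero_imp_eq_zero (G y.1)).1 (hG y.1) _
    (fun d => v (y.1, d)) (fun d hd => ?_) hfin y.2
      (Finset.mem_image_of_mem _ (Finset.mem_filter.2 ⟨hy, rfl⟩))
  · exact hG'
  · obtain ⟨x, hx, rfl⟩ := Finset.mem_image.1 hd
    rw [← (Finset.mem_filter.1 hx).2]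
    exact hv x (Finset.mem_filter.1 hx).1

/-- Partial suprema of an independent doubly indexed family are independent. -/
theorem iSupIndep_iSup_of_prod {G : ι × κ → Submodule R M} (hG : iSupIndep G) :
    iSupIndep fun i => ⨆ c, G (i, c) := by
  intro i
  refine (hG.disjoint_biSup_biSup (s := {x | x.1 = i}) (t := {x | x.1 ≠ i})
    (by rw [Set.disjoint_left]; intro x hx hx'; exact hx' hx)).mono ?_ ?_
  · exact iSup_le fun c => le_biSup G (show (i, c) ∈ {x : ι × κ | x.1 = i} from rfl)
  · exact iSup₂_le fun j hj => iSup_le fun c =>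
      le_biSup G (show (j, c) ∈ {x : ι × κ | x.1 ≠ i} from hj)

theorem iSupIndep_map {N : Type*} [AddCommGroup N] [Module R N] {G : ι → Submodule R M}
    (hG : iSupIndep G) (f : M →ₗ[R] N) (hf : Function.Injective f) :
    iSupIndep fun i => (G i).map f := by
  intro i
  have := (Submodule.disjoint_map hf (hG i))
  simpa only [Submodule.map_iSup] using this

/-- For a finite independent family spanning the whole module, every element has unique
components. -/
theorem bijective_sum_of_iSupIndep [Fintype ι] {E : ι → Submodule R M} (hE : iSupIndep E)
    (htop : ⨆ i, E i = ⊤) : Function.Bijective fun x : (∀ i, E i) => ∑ i, (x i : M) := by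
  constructor
  · intro x y hxy
    ext i
    exact (iSupIndep_iff_finsetSum_eq_imp_eq E).1 hE Finset.univ (fun i => x i) (fun i => y i)
      (fun i _ => ⟨(x i).2, (y i).2⟩) hxy i (Finset.mem_univ i)
  · intro u
    have hu : u ∈ ⨆ i, E i := htop ▸ Submodule.mem_top
    obtain ⟨f, hf, rfl⟩ := (Submodule.mem_iSup_iff_exists_finsupp _ _).1 hu
    refine ⟨fun i => ⟨f i, hf i⟩, ?_⟩
    simp [Finsupp.sum_fintype]

/-- If the whole module is the direct sum of the images of `N` under finitely many injective maps,
then every element has unique components in `N`. -/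
theorem bijective_sum_map_of_iSupIndep [Fintype ι] {N : Submodule R M} {f : ι → M →ₗ[R] M}
    (hf : ∀ i, Function.Injective (f i)) (hind : iSupIndep fun i => N.map (f i))
    (htop : ⨆ i, N.map (f i) = ⊤) :
    Function.Bijective fun x : ι → N => ∑ i, f i (x i) :=
  (bijective_sum_of_iSupIndep hind htop).comp
    (Equiv.piCongrRight fun i => (Submodule.equivMapOfInjective (f i) (hf i) N).toEquiv).bijective

end Independence

/-! ### Decomposition of the untwisted algebra into monomial translates -/

section Monomials

variable {k : Type*} [Field k] {A : Type*} [Ring A] [Algebra k A] {n : ℕ}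

/-- Multiplication by the Laurent monomial with exponent `a`. -/
def monomialMul (a : Fin n → ℤ) : Untwisted k A n →ₗ[k] Untwisted k A n :=
  Algebra.lsmul k k (Untwisted k A n) (AddMonoidAlgebra.single a 1 : Laurent k n)

theorem monomialMul_apply (a : Fin n → ℤ) (x : Untwisted k A n) :
    monomialMul a x = (AddMonoidAlgebra.single a 1 : Laurent k n) • x := rfl

theorem monomialMul_comp (a b : Fin n → ℤ) :
    monomialMul (k := k) (A := A) a ∘ₗ monomialMul b = monomialMul (a + b) := by
  ext x
  simp [monomialMul_apply, smul_smul, AddMonoidAlgebra.single_mul_single]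

theorem monomialMul_zero : monomialMul (k := k) (A := A) (0 : Fin n → ℤ) = LinearMap.id := by
  apply LinearMap.ext
  intro x
  rw [monomialMul_apply, ← AddMonoidAlgebra.one_def, one_smul, LinearMap.id_apply]

theorem monomialMul_injective (a : Fin n → ℤ) :
    Function.Injective (monomialMul (k := k) (A := A) a) := by
  refine Function.LeftInverse.injective (g := monomialMul (-a)) fun x => ?_
  rw [← LinearMap.comp_apply, monomialMul_comp, neg_add_cancel, monomialMul_zero]
  rfl

theorem loopSpace_eq_iSup {m : ℕ} (p : Fin n) (Γ : ZMod m → Submodule k (Untwisted k A n)) :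
    loopSpace p Γ = ⨆ i : ℤ, (Γ (i : ZMod m)).map (monomialMul (Pi.single p i)) := rfl

namespace Tower

variable {m : Fin n → ℕ} (T : Tower k A n m)

variable (m) in
/-- Exponents reduced modulo `m i` in the coordinates `i < q`. -/
def reducedExponents (q : Fin (n + 1)) : Set (Fin n → ℤ) :=
  {a | ∀ i, i.castSucc < q → 0 ≤ a i ∧ a i < m i}

/-- At stage `0` no coordinate is restricted, so all monomials occur; they form a `k`-basis of the
Laurent ring, and the translates of `1 ⊗ A` are the summands of the tensor product along that basis.
-/
theorem iSupIndep_base :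
    iSupIndep fun a : reducedExponents m 0 => (T.space 0).map (monomialMul a.1) := by
  classical
  rw [iSupIndep_iff_finsetSum_eq_zero_imp_eq_zero]
  intro s v hv h0
  have hx : ∀ a : reducedExponents m 0, ∃ x : A, a ∈ s →
      v a = (AddMonoidAlgebra.single a.1 1 : Laurent k n) ⊗ₜ x := by
    intro a
    by_cases ha : a ∈ s
    · obtain ⟨y, hy, hya⟩ := hv a ha
      rw [T.space_zero] at hy
      obtain ⟨x, rfl⟩ := hy
      refine ⟨x, fun _ => ?_⟩
      rw [← hya, monomialMul_apply]
      simp [TensorProduct.smul_tmul']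
    · exact ⟨0, fun h => absurd h ha⟩
  choose x hx using hx
  have key := TensorProduct.sum_tmul_basis_left_eq_zero (N := A)
    (AddMonoidAlgebra.basis (Fin n → ℤ) k)
    (∑ a ∈ s, Finsupp.single a.1 (x a)) (by
      rw [← h0, ← Finsupp.sum_finsetSum_index (by simp) (by simp [TensorProduct.tmul_add])]
      refine Finset.sum_congr rfl fun a ha => ?_
      rw [hx a ha]
      simp)
  intro a ha
  have := DFunLike.congr_fun key a.1
  rw [Finsupp.finsetSum_apply, Finset.sum_eq_single a] at this
  · rw [hx a ha]
    simp only [Finsupp.single_eq_same, Finsupp.coe_zero, Pi.zero_apply] at this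
    rw [this, TensorProduct.tmul_zero]
  · intro b _ hba
    exact Finsupp.single_eq_of_ne fun h => hba (Subtype.ext h.symm)
  · exact fun h => absurd ha h

theorem iSup_base :
    ⨆ a : reducedExponents m 0, (T.space 0).map (monomialMul a.1) = ⊤ := by
  rw [eq_top_iff]
  intro u _
  obtain ⟨c, rfl⟩ := TensorProduct.eq_repr_basis_left (AddMonoidAlgebra.basis (Fin n → ℤ) k) u
  refine Submodule.sum_mem _ fun a _ => ?_
  have ha : a ∈ reducedExponents m 0 := fun i hi => absurd hi (Fin.not_lt_zero _)
  refine Submodule.mem_iSup_of_mem (⟨a, ha⟩ : reducedExponents m 0) ⟨1 ⊗ₜ c a, ?_, ?_⟩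
  · rw [T.space_zero]
    exact ⟨c a, rfl⟩
  · rw [monomialMul_apply]
    simp [TensorProduct.smul_tmul']

/-- Pairs of a reduced exponent and an integer, as pairs of a less reduced exponent and a
residue. -/
def unreduce (p : Fin n) (x : reducedExponents m p.succ × ℤ) :
    reducedExponents m p.castSucc × ZMod (m p) :=
  (⟨x.1.1 + Pi.single p x.2, fun i hi => by
    have hip : i ≠ p := fun h => by simp [h] at hi
    have := x.1.2 i (hi.trans (Fin.castSucc_lt_succ))
    simpa [Pi.single_apply, hip] using this⟩, (x.2 : ZMod (m p)))

/-- Only coordinate `p` matters: `a p + i = b p + j` and `m p ∣ j - i`, while `|a p - b p| < m p`,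
so `i = j`. -/
theorem unreduce_injective (p : Fin n) : Function.Injective (unreduce (m := m) p) := by
  rintro ⟨⟨a, ha⟩, i⟩ ⟨⟨b, hb⟩, j⟩ h
  simp only [unreduce, Prod.mk.injEq] at h
  obtain ⟨h0, h2⟩ := h
  have h1 := congrArg Subtype.val h0
  dsimp only at h1
  have hp := congrFun h1 p
  simp only [Pi.add_apply, Pi.single_eq_same] at hp
  have hap := ha p (Fin.castSucc_lt_succ)
  have hbp := hb p (Fin.castSucc_lt_succ)
  have hmod := (ZMod.intCast_eq_intCast_iff_dvd_sub i j (m p)).1 h2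
  have hij : j - i = 0 := by
    apply Int.eq_zero_of_abs_lt_dvd hmod
    rw [abs_lt]
    constructor <;> linarith [hap.1, hap.2, hbp.1, hbp.2]
  have hij : i = j := by linarith
  subst hij
  simpa using h1

theorem unreduce_surjective (p : Fin n) (hm : 0 < m p) :
    Function.Surjective (unreduce (m := m) p) := by
  rintro ⟨⟨a, ha⟩, c⟩
  obtain ⟨j, rfl⟩ := ZMod.intCast_surjective c
  -- The exponent `a p` must split as `r + i` with `0 ≤ r < m p` and `i ≡ j` modulo `m p`, which
  -- forces this `r`.
  set r : ℤ := (a p - j) % (m p) with hr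
  have hm' : (0 : ℤ) < m p := by exact_mod_cast hm
  refine ⟨(⟨a - Pi.single p (a p - r), fun i hi => ?_⟩, a p - r), ?_⟩
  · by_cases hip : i = p
    · subst hip
      simpa using ⟨Int.emod_nonneg _ hm'.ne', Int.emod_lt_of_pos _ hm'⟩
    · have hlt : i.castSucc < p.castSucc := by
        rw [Fin.castSucc_lt_castSucc_iff]
        exact lt_of_le_of_ne (Fin.castSucc_lt_succ_iff.1 hi) hip
      simpa [Pi.single_apply, hip] using ha i hlt
  · simp only [unreduce, Prod.mk.injEq, sub_add_cancel, true_and]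
    rw [ZMod.intCast_eq_intCast_iff_dvd_sub]
    have := Int.emod_add_mul_ediv (a p - j) (m p)
    exact ⟨-((a p - j) / (m p)), by rw [hr]; linarith⟩

/-- In the inductive step each translate is refined by the grading into pieces `z^a Γ_c`. The
translate by `z^b` of the next algebra gathers the pieces with `a = b + i e_p` and `c = i mod m_p`,
and `unreduce` shows that every piece is used exactly once. -/
theorem decomposition (hm : ∀ p, 0 < m p) (q : Fin (n + 1)) :
    (iSupIndep fun a : reducedExponents m q => (T.space q).map (monomialMul a.1)) ∧
      ⨆ a : reducedExponents m q, (T.space q).map (monomialMul a.1) = ⊤ := by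
  induction q using Fin.induction with
  | zero => exact ⟨T.iSupIndep_base, T.iSup_base⟩
  | succ p ih =>
    obtain ⟨hind, htop⟩ := ih
    let G : reducedExponents m p.castSucc × ZMod (m p) → Submodule k (Untwisted k A n) :=
      fun x => (T.grading p x.2).map (monomialMul x.1.1)
    have hG : iSupIndep G := by
      refine iSupIndep_prod_of_le hind (G := fun a c => (T.grading p c).map (monomialMul a.1))
        (fun a => iSupIndep_map (T.isGrading p).indep _ (monomialMul_injective _)) fun a c => ?_
      rw [← (T.isGrading p).iSup_eq]
      exact Submodule.map_mono (le_iSup _ _)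
    have hGtop : ⨆ x, G x = ⊤ := by
      rw [iSup_prod, ← htop]
      refine iSup_congr fun a => ?_
      rw [← (T.isGrading p).iSup_eq, Submodule.map_iSup]
    have hE : ∀ b : reducedExponents m p.succ,
        (T.space p.succ).map (monomialMul b.1) = ⨆ i : ℤ, G (unreduce p (b, i)) := by
      intro b
      rw [T.space_succ, loopSpace_eq_iSup, Submodule.map_iSup]
      refine iSup_congr fun i => ?_
      rw [← Submodule.map_comp, monomialMul_comp]
      rfl
    rw [funext hE]
    refine ⟨iSupIndep_iSup_of_prod (G := fun x => G (unreduce p x))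
      (hG.comp (unreduce_injective p)), ?_⟩
    rw [← iSup_prod (f := fun x => G (unreduce p x)), ← hGtop]
    exact (unreduce_surjective p (hm p)).iSup_comp G

end Tower
end Monomials
end LoopAlgebra
end

noncomputable section
namespace LoopAlgebra

/-! ### Descent of the Azumaya property and of the rank -/

section Descent

variable {C S L ι : Type*} [CommRing C] [CommRing S] [Algebra C S] [Ring L] [Algebra C L]

/-- The `S`-bilinear extension of `L ⊗ Lᵐᵒᵖ` to `S ⊗ L`. -/
def tensorOpBaseChange : S ⊗[C] (L ⊗[C] Lᵐᵒᵖ) ≃ₗ[S] (S ⊗[C] L) ⊗[S] (S ⊗[C] L)ᵐᵒᵖ :=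
  (TensorProduct.AlgebraTensorModule.distribBaseChange C S L Lᵐᵒᵖ).trans
    (TensorProduct.AlgebraTensorModule.congr (.refl S _)
      ((TensorProduct.AlgebraTensorModule.congr (.refl S S)
        (MulOpposite.opLinearEquiv C : L ≃ₗ[C] Lᵐᵒᵖ).symm).trans
          (MulOpposite.opLinearEquiv S)))

theorem tensorOpBaseChange_tmul (s : S) (x : L) (y : Lᵐᵒᵖ) :
    tensorOpBaseChange (C := C) (s ⊗ₜ (x ⊗ₜ y)) =
      (s ⊗ₜ x) ⊗ₜ MulOpposite.op ((1 : S) ⊗ₜ y.unop) := rfl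

/-- Compatibility of the sandwich map with base change, through which its bijectivity is transferred
from `S ⊗ L` to `L`. -/
theorem mulLeftRight_tensorOpBaseChange (s : S) (t : L ⊗[C] Lᵐᵒᵖ) (w : L) :
    AlgHom.mulLeftRight S (S ⊗[C] L) (tensorOpBaseChange (s ⊗ₜ t)) (1 ⊗ₜ w) =
      s ⊗ₜ AlgHom.mulLeftRight C L t w := by
  induction t using TensorProduct.induction_on with
  | zero => simp
  | tmul x y => simp [tensorOpBaseChange_tmul]
  | add t u ht hu => simp only [TensorProduct.tmul_add, map_add, LinearMap.add_apply, ht, hu]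

variable (b : Module.Basis ι C S) {i₀ : ι}

theorem equivFinsuppOfBasisLeft_one_tmul [DecidableEq ι] (hb : b i₀ = 1) (w : L) :
    TensorProduct.equivFinsuppOfBasisLeft b ((1 : S) ⊗ₜ[C] w) i₀ = w := by
  rw [TensorProduct.equivFinsuppOfBasisLeft_apply_tmul_apply, ← hb]
  simp

/-- Descent of the Azumaya property along an extension that is free on a finite basis
containing `1`. -/
theorem isAzumaya_of_baseChange [Finite ι] (hb : b i₀ = 1) [Module.Free S (S ⊗[C] L)]
    [hAz : IsAzumaya S (S ⊗[C] L)] :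
    IsAzumaya C L := by
  classical
  have : Module.Free C S := .of_basis b
  have : Module.Finite C S := .of_basis b
  have : Module.Finite C (S ⊗[C] L) := .trans S _
  have : Module.Free C (S ⊗[C] L) := .trans (S := S)
  -- The coordinate along `b i₀ = 1` is a `C`-linear retraction of `w ↦ 1 ⊗ w`. It exhibits `L` as a
  -- direct summand of `S ⊗ L`, which is finite free over `C`.
  let r : S ⊗[C] L →ₗ[C] L :=
    Finsupp.lapply i₀ ∘ₗ (TensorProduct.equivFinsuppOfBasisLeft b).toLinearMap
  have hr : ∀ w, r ((1 : S) ⊗ₜ w) = w := equivFinsuppOfBasisLeft_one_tmul b hb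
  have hrs : ∀ s w, r (s ⊗ₜ w) = b.repr s i₀ • w := fun s w =>
    TensorProduct.equivFinsuppOfBasisLeft_apply_tmul_apply b s w i₀
  have hsec : r ∘ₗ TensorProduct.mk C S L 1 = LinearMap.id := LinearMap.ext hr
  have hinj1 : ∀ (M : Type _) [AddCommGroup M] [Module C M] (t : M),
      (1 : S) ⊗ₜ[C] t = 0 → t = 0 := by
    intro M _ _ t ht
    have := congrArg (fun z => TensorProduct.equivFinsuppOfBasisLeft b z i₀) ht
    simpa [TensorProduct.equivFinsuppOfBasisLeft_apply_tmul_apply, ← hb] using this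
  have hproj : Module.Projective C L := .of_split _ _ hsec
  have hfin : Module.Finite C L := .of_surjective r fun w => ⟨_, hr w⟩
  have hfaith : FaithfulSMul C L := by
    rw [faithfulSMul_iff_algebraMap_injective, injective_iff_map_eq_zero]
    intro c hc
    have h1 : algebraMap S (S ⊗[C] L) (algebraMap C S c) = 0 := by
      rw [← IsScalarTower.algebraMap_apply, Algebra.TensorProduct.algebraMap_apply',
        hc, TensorProduct.tmul_zero]
    have h2 : algebraMap C S c = 0 :=
      FaithfulSMul.algebraMap_injective S (S ⊗[C] L) (by rw [h1, map_zero])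
    have h3 := congrArg (fun z => b.repr z i₀) h2
    simpa [Algebra.algebraMap_eq_smul_one, ← hb] using h3
  refine { hproj, hfaith, hfin with bij := ⟨?_, ?_⟩ }
  · rw [injective_iff_map_eq_zero]
    intro t ht
    refine hinj1 _ t (tensorOpBaseChange.injective (hAz.bij.1 ?_))
    rw [map_zero, map_zero]
    refine LinearMap.ext fun u => ?_
    induction u using TensorProduct.induction_on with
    | zero => simp
    | tmul s w =>
      have := mulLeftRight_tensorOpBaseChange (1 : S) t w
      rw [ht] at this
      rw [← mul_one s, ← smul_eq_mul, ← TensorProduct.smul_tmul', map_smul, this]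
      simp
    | add u v hu hv => rw [map_add, hu, hv]; simp
  · intro f
    -- A preimage of `f` is the `i₀`-coordinate of a preimage of its base change.
    obtain ⟨τ, hτ⟩ := hAz.bij.2 (f.baseChange S)
    obtain ⟨t, rfl⟩ := tensorOpBaseChange.surjective τ
    refine ⟨TensorProduct.equivFinsuppOfBasisLeft b t i₀, LinearMap.ext fun w => ?_⟩
    have key : ∀ t : S ⊗[C] (L ⊗[C] Lᵐᵒᵖ),
        r (AlgHom.mulLeftRight S (S ⊗[C] L) (tensorOpBaseChange t) (1 ⊗ₜ w)) =
          AlgHom.mulLeftRight C L (TensorProduct.equivFinsuppOfBasisLeft b t i₀) w := by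
      intro t
      induction t using TensorProduct.induction_on with
      | zero => simp
      | tmul s t =>
        rw [mulLeftRight_tensorOpBaseChange, hrs,
          TensorProduct.equivFinsuppOfBasisLeft_apply_tmul_apply, map_smul, LinearMap.smul_apply]
      | add t u ht hu =>
        simp only [map_add, LinearMap.add_apply, Finsupp.add_apply, ht, hu]
    rw [← key, hτ, LinearMap.baseChange_tmul, hr]

/-- A finite projective module that becomes free of rank `r` after a faithfully flat extension has
constant rank `r`. -/
theorem hasConstantRank_of_baseChange [Module.FaithfullyFlat C S] [Module.Projective C L]
    [Module.Finite C L] [Module.Free S (S ⊗[C] L)] (d : ℕ)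
    (hd : Module.finrank S (S ⊗[C] L) = d) : HasConstantRank C L d := by
  intro 𝔪 _
  -- The rank at `𝔪` is read off at a prime `P` of `S` lying over it.
  obtain ⟨P, hP⟩ := PrimeSpectrum.comap_surjective_of_faithfullyFlat (A := C) (B := S)
    ⟨𝔪, inferInstance⟩
  refine ⟨Module.free_of_flat_of_isLocalRing, inferInstance, ?_⟩
  have : Nontrivial S := ⟨0, 1, fun h => P.2.ne_top ((Ideal.eq_top_iff_one _).2 (h ▸ P.1.zero_mem))⟩
  have h := Module.rankAtStalk_baseChange (R := C) (M := L) P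
  rw [Module.rankAtStalk_eq_finrank_of_free, hP] at h
  rw [← hd]
  exact h.symm

end Descent

/-! ### Base change from a decomposition along a basis -/

section BaseChange

variable {C S L U ι : Type*} [CommRing C] [CommRing S] [Algebra C S] [Ring L] [Algebra C L]
  [Ring U] [Algebra S U] [Algebra C U] [IsScalarTower C S U]

/-- The `S`-linear extension of a homomorphism of `C`-algebras to an `S`-algebra. -/
def baseChangeLift (g : L →ₐ[C] U) : S ⊗[C] L →ₐ[S] U :=
  Algebra.TensorProduct.lift (Algebra.ofId S U) g fun s x => by
    rw [Algebra.ofId_apply]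
    exact Algebra.commute_algebraMap_left s (g x)

theorem baseChangeLift_tmul (g : L →ₐ[C] U) (s : S) (x : L) :
    baseChangeLift g (s ⊗ₜ[C] x) = s • g x := by
  rw [Algebra.smul_def]
  exact Algebra.TensorProduct.lift_tmul _ _ _ _ _

/-- If `U` decomposes as `⨁ bᵢ L` for a basis `b` of `S` over `C`, then `S ⊗ L ≃ U`. -/
theorem bijective_baseChangeLift [Fintype ι] (b : Module.Basis ι C S) (g : L →ₐ[C] U)
    (hg : Function.Bijective fun x : ι → L => ∑ i, b i • g (x i)) :
    Function.Bijective (baseChangeLift (S := S) g) := by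
  classical
  have h : (fun x : ι → L => ∑ i, b i • g (x i)) = baseChangeLift (S := S) g ∘
      (TensorProduct.equivFinsuppOfBasisLeft b).symm ∘
        (Finsupp.linearEquivFunOnFinite C L ι).symm := by
    funext x
    simp only [Function.comp_apply, TensorProduct.equivFinsuppOfBasisLeft_symm_apply]
    rw [Finsupp.sum_fintype _ _ (by simp), map_sum]
    exact Finset.sum_congr rfl fun i _ => (baseChangeLift_tmul g _ _).symm
  rw [h] at hg
  exact (Function.Bijective.of_comp_iff _
    ((TensorProduct.equivFinsuppOfBasisLeft b).symm.bijective.comp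
      (Finsupp.linearEquivFunOnFinite C L ι).symm.bijective)).1 hg

end BaseChange
end LoopAlgebra
end

noncomputable section
namespace LoopAlgebra

/-! ### The centroid of a subalgebra `L` with `U = ⨁ sᵢ L` -/

section CentroidOfForm

variable {k S U ι : Type*} [Field k] [CommRing S] [Algebra k S] [Ring U] [Algebra k U]
  [Algebra S U] [IsScalarTower k S U] (L : Subalgebra k U)

/-- Evaluation at `1` embeds the centroid into the algebra. -/
def centroidEval : centroid k L →ₐ[k] U :=
  AlgHom.ofLinearMap
    { toFun := fun χ => (χ.1 1 : U)
      map_add' := fun _ _ => rfl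
      map_smul' := fun _ _ => rfl } rfl (fun χ ψ => by
        have h := (χ.2 1 (ψ.1 1)).1
        rw [one_mul] at h
        exact congrArg Subtype.val h)

theorem centroidEval_apply (χ : centroid k L) : centroidEval L χ = (χ.1 1 : U) := rfl

theorem centroidEval_mul (χ : centroid k L) (x : L) :
    centroidEval L χ * (x : U) = (χ.1 x : U) := by
  have h := (χ.2 1 x).1
  rw [one_mul] at h
  exact (congrArg Subtype.val h).symm

theorem mul_centroidEval (χ : centroid k L) (x : L) :
    (x : U) * centroidEval L χ = (χ.1 x : U) := by
  have h := (χ.2 x 1).2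
  rw [mul_one] at h
  exact (congrArg Subtype.val h).symm

theorem centroidEval_injective : Function.Injective (centroidEval L) := by
  intro χ ψ h
  refine Subtype.ext (LinearMap.ext fun x => Subtype.ext ?_)
  rw [← centroidEval_mul, h, centroidEval_mul]

theorem exists_centroidEval_eq {z : U} (hz : z ∈ L) (hc : ∀ x ∈ L, z * x = x * z) :
    ∃ χ : centroid k L, centroidEval L χ = z := by
  refine ⟨⟨LinearMap.mulLeft k ⟨z, hz⟩, fun x y => ⟨?_, ?_⟩⟩, ?_⟩
  · exact (mul_assoc _ _ _).symm
  · apply Subtype.ext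
    change z * (x * y : U) = x * (z * y)
    rw [← mul_assoc, hc x x.2, mul_assoc]
  · rw [centroidEval_apply]
    simp

variable [Fintype ι] {s : ι → S}
  (hs : Function.Bijective fun x : ι → L => ∑ i, s i • (x i : U))

include hs

omit [Algebra k S] [IsScalarTower k S U] in
-- Every element of `U` is an `S`-combination of elements of `L`, and `S` acts centrally.
theorem commute_of_commute_subalgebra {z : U} (hz : ∀ x ∈ L, z * x = x * z) (u : U) :
    z * u = u * z := by
  obtain ⟨x, rfl⟩ := hs.2 u
  simp only [Finset.mul_sum, Finset.sum_mul]
  exact Finset.sum_congr rfl fun i _ => by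
    rw [mul_smul_comm, smul_mul_assoc, hz _ (x i).2]

theorem centroidEval_mem_range [Algebra.IsCentral S U] (χ : centroid k L) :
    centroidEval L χ ∈ (IsScalarTower.toAlgHom k S U).range := by
  have h : centroidEval L χ ∈ Subalgebra.center S U := by
    rw [Subalgebra.mem_center_iff]
    intro u
    exact (commute_of_commute_subalgebra L hs (fun x hx => by
      rw [centroidEval_mul L χ ⟨x, hx⟩, mul_centroidEval L χ ⟨x, hx⟩]) u).symm
  obtain ⟨t, ht⟩ := Algebra.mem_bot.1 (Algebra.IsCentral.out h)
  exact ⟨t, ht⟩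

/-- The action of the centroid on `L` through scalars in `S`. -/
theorem exists_centroidScalar [Algebra.IsCentral S U] [FaithfulSMul S U] :
    ∃ υ : centroid k L →ₐ[k] S, ∀ χ, algebraMap S U (υ χ) = centroidEval L χ := by
  have hinj : Function.Injective (IsScalarTower.toAlgHom k S U) :=
    FaithfulSMul.algebraMap_injective S U
  refine ⟨((AlgEquiv.ofInjective _ hinj).symm : _ →ₐ[k] S).comp
    ((centroidEval L).codRestrict _ (centroidEval_mem_range L hs)), fun χ => ?_⟩
  exact congrArg Subtype.val ((AlgEquiv.ofInjective _ hinj).apply_symm_apply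
    ⟨centroidEval L χ, centroidEval_mem_range L hs χ⟩)

variable {υ : centroid k L →ₐ[k] S} (hυ : ∀ χ, algebraMap S U (υ χ) = centroidEval L χ)

include hυ

omit hs [IsScalarTower k S U] in
theorem centroidScalar_smul (χ : centroid k L) (x : L) : υ χ • (x : U) = (χ.1 x : U) := by
  rw [Algebra.smul_def, hυ, centroidEval_mul]

omit [IsScalarTower k S U] in
-- This says that `S` is free over the centroid with basis `s`, by restricting `U = ⨁ sᵢ L` to
-- scalars.
theorem bijective_sum_centroid [FaithfulSMul S U] :
    Function.Bijective fun c : ι → centroid k L => ∑ i, s i * υ (c i) := by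
  have hmap : ∀ c : ι → centroid k L, algebraMap S U (∑ i, s i * υ (c i)) =
      ∑ i, s i • (((c i).1 1 : L) : U) := by
    intro c
    rw [map_sum]
    exact Finset.sum_congr rfl fun i _ => by
      rw [map_mul, hυ, Algebra.smul_def, centroidEval_apply]
  constructor
  · intro c d hcd
    have h := congrArg (algebraMap S U) hcd
    simp only [hmap] at h
    have h' := hs.1 h
    funext i
    exact centroidEval_injective L (congrArg Subtype.val (congrFun h' i))
  · intro t
    obtain ⟨x, hx⟩ := hs.2 (algebraMap S U t)
    dsimp only at hx
    -- Since `t y = y t`, the families `xᵢ y` and `y xᵢ` are components of the same element, so they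
    -- agree.
    have hcomm : ∀ i, ∀ y ∈ L, (x i : U) * y = y * x i := by
      intro i y hy
      have h : (fun i => x i * ⟨y, hy⟩) = fun i => ⟨y, hy⟩ * x i := by
        apply hs.1
        have h1 : (∑ i, s i • (x i : U)) * y = y * ∑ i, s i • (x i : U) := by
          rw [hx, Algebra.commutes]
        simp only [Finset.sum_mul, Finset.mul_sum, smul_mul_assoc, mul_smul_comm] at h1
        exact h1
      exact congrArg Subtype.val (congrFun h i)
    choose c hc using fun i => exists_centroidEval_eq L (x i).2 (hcomm i)
    refine ⟨c, FaithfulSMul.algebraMap_injective S U ?_⟩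
    dsimp only
    rw [hmap, ← hx]
    exact Finset.sum_congr rfl fun i _ => by rw [← centroidEval_apply, hc]

omit hs [IsScalarTower k S U] in
theorem centroidScalar_injective : Function.Injective υ := fun χ ψ h =>
  centroidEval_injective L (by rw [← hυ, h, hυ])

omit [IsScalarTower k S U] in
/-- A subalgebra `L` of a matrix algebra `U ≃ M_ℓ(S)` with `U = ⨁ sᵢ L` is an Azumaya algebra over its
centroid, split by `S`. -/
theorem isAzumaya_and_isSplitBy [FaithfulSMul S U] [Nontrivial S] {i₀ : ι} (h1 : s i₀ = 1) {ℓ : ℕ}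
    (hℓ : 0 < ℓ) (e : U ≃ₐ[S] Matrix (Fin ℓ) (Fin ℓ) S) :
    IsAzumaya (centroid k L) L ∧ HasConstantRank (centroid k L) L (ℓ ^ 2) ∧
      IsSplitBy (centroid k L) L (υ : centroid k L →+* S) ℓ := by
  -- Both `S` and `U` become algebras over the centroid through `υ`, so that the inclusion of `L` is
  -- linear over it.
  let _ : Algebra (centroid k L) S := (υ : centroid k L →+* S).toAlgebra
  let _ : Algebra (centroid k L) U := Algebra.compHom U (υ : centroid k L →+* S)
  have : IsScalarTower (centroid k L) S U := ⟨fun c t u => mul_smul (υ c) t u⟩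
  let g : L →ₐ[centroid k L] U :=
    { toRingHom := L.val
      commutes' := fun χ => by
        change ((χ.1 1 : L) : U) = algebraMap S U (υ χ)
        rw [hυ, centroidEval_apply] }
  let f : (ι → centroid k L) →ₗ[centroid k L] S :=
    { toFun := fun c => ∑ i, s i * υ (c i)
      map_add' := fun c d => by simp [mul_add, Finset.sum_add_distrib]
      map_smul' := fun χ c => by
        change _ = υ χ * _
        simp [Finset.mul_sum, mul_left_comm] }
  let b : Module.Basis ι (centroid k L) S :=
    .ofEquivFun (LinearEquiv.ofBijective f (bijective_sum_centroid L hs hυ)).symm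
  have hb : ∀ i, b i = s i := by
    classical
    intro i
    rw [Module.Basis.coe_ofEquivFun]
    change ∑ j, s j * υ ((Pi.single i 1 : ι → centroid k L) j) = s i
    rw [Finset.sum_eq_single i (fun j _ hj => by simp [hj]) (by simp)]
    simp
  have hg : Function.Bijective fun x : ι → L => ∑ i, b i • g (x i) := by
    simp only [hb]
    exact hs
  let E : S ⊗[centroid k L] L ≃ₐ[S] Matrix (Fin ℓ) (Fin ℓ) S :=
    (AlgEquiv.ofBijective _ (bijective_baseChangeLift b g hg)).trans e
  have : Nonempty (Fin ℓ) := ⟨⟨0, hℓ⟩⟩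
  have : IsAzumaya S (Matrix (Fin ℓ) (Fin ℓ) S) := IsAzumaya.matrix S (Fin ℓ)
  have : IsAzumaya S (S ⊗[centroid k L] L) := IsAzumaya.of_AlgEquiv S _ _ E.symm
  have : Module.Free S (S ⊗[centroid k L] L) := .of_equiv E.symm.toLinearEquiv
  have : Module.Free (centroid k L) S := .of_basis b
  have hAz : IsAzumaya (centroid k L) L := isAzumaya_of_baseChange b ((hb i₀).trans h1)
  refine ⟨hAz, hasConstantRank_of_baseChange (S := S) _ ?_, centroidScalar_injective L hυ,
    inferInstance, ⟨E⟩⟩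
  rw [E.toLinearEquiv.finrank_eq, Module.finrank_matrix]
  simp [sq]

end CentroidOfForm

/-! ### Primeness -/

section Prime

variable {k S U ι : Type*} [Field k] [CommRing S] [Algebra k S] [Ring U] [Algebra k U]
  [Algebra S U] [IsScalarTower k S U] (L : Subalgebra k U)

/-- With `E_{ij}` a matrix unit, the `(a, c)` entry of `x E_{ij} y` is `x_{ai} y_{jc}`, nonzero over
a domain when both factors are. -/
theorem eq_zero_or_eq_zero_of_matrix_mul_mul [IsDomain S] {ℓ : ℕ}
    (e : U ≃ₐ[S] Matrix (Fin ℓ) (Fin ℓ) S) {x y : U} (h : ∀ u, x * u * y = 0) :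
    x = 0 ∨ y = 0 := by
  by_contra! hxy
  obtain ⟨a, i, hai⟩ : ∃ a i, e x a i ≠ 0 := by
    by_contra! h0
    exact hxy.1 (e.injective (by rw [map_zero]; exact Matrix.ext h0))
  obtain ⟨j, c, hjc⟩ : ∃ j c, e y j c ≠ 0 := by
    by_contra! h0
    exact hxy.2 (e.injective (by rw [map_zero]; exact Matrix.ext h0))
  have := congrArg (fun z => e z a c) (h (e.symm (Matrix.single i j 1)))
  simp only [map_mul, AlgEquiv.apply_symm_apply, map_zero, Matrix.zero_apply] at this
  rw [Matrix.mul_apply, Finset.sum_eq_single j] at this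
  · simp [hai, hjc] at this
  · intro d _ hd
    simp [hd]
  · simp

omit [Algebra k S] [IsScalarTower k S U] in
-- For `x ∈ I` and `y ∈ J`, `x L y ⊆ I J = 0`, and this extends by `S`-linearity to `x U y = 0`.
theorem isPrimeAlgebra_of_matrix [IsDomain S] [Fintype ι] {s : ι → S}
    (hs : Function.Bijective fun x : ι → L => ∑ i, s i • (x i : U)) {ℓ : ℕ}
    (e : U ≃ₐ[S] Matrix (Fin ℓ) (Fin ℓ) S) : IsPrimeAlgebra k L := by
  intro I J hI hJ hIJ
  by_contra! h
  obtain ⟨x, hx, hx0⟩ := (Submodule.ne_bot_iff I).1 h.1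
  obtain ⟨y, hy, hy0⟩ := (Submodule.ne_bot_iff J).1 h.2
  have hxy : ∀ w : L, x * w * y = 0 := fun w => by
    rw [← Submodule.mem_bot k, ← hIJ]
    exact Submodule.mul_mem_mul (hI w x hx).2 hy
  have hU : ∀ u : U, (x : U) * u * y = 0 := by
    intro u
    obtain ⟨w, rfl⟩ := hs.2 u
    simp only [Finset.mul_sum, Finset.sum_mul]
    refine Finset.sum_eq_zero fun i _ => ?_
    rw [mul_smul_comm, smul_mul_assoc]
    have := congrArg Subtype.val (hxy (w i))
    rw [show (x : U) * w i * y = 0 from this, smul_zero]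
  rcases eq_zero_or_eq_zero_of_matrix_mul_mul e hU with h | h
  · exact hx0 (Subtype.ext h)
  · exact hy0 (Subtype.ext h)

end Prime

/-! ### Application to loop algebras -/

section Main

/-- `S ⊗ M_ℓ(k) ≃ M_ℓ(S)` as `S`-algebras. -/
def tensorMatrixEquiv (k S : Type*) [Field k] [CommRing S] [Algebra k S] (ℓ : ℕ) :
    S ⊗[k] Matrix (Fin ℓ) (Fin ℓ) k ≃ₐ[S] Matrix (Fin ℓ) (Fin ℓ) S :=
  { (matrixEquivTensor (Fin ℓ) k S).symm with
    commutes' := fun s => by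
      change (matrixEquivTensor (Fin ℓ) k S).symm (s ⊗ₜ 1) = _
      rw [matrixEquivTensor_apply_symm, Matrix.map_one _ (map_zero _) (map_one _),
        Algebra.algebraMap_eq_smul_one] }

namespace Tower
variable {k : Type*} [Field k] {A : Type*} [Ring A] [Algebra k A] {n : ℕ} {m : Fin n → ℕ}
  (T : Tower k A n m)

theorem finite_reducedExponents : (reducedExponents m (Fin.last n)).Finite := by
  refine (Set.Finite.pi' fun i => Set.finite_Ico (0 : ℤ) (m i)).subset fun a ha i => ?_
  exact ha i (Fin.castSucc_lt_last i)

instance : Fintype (reducedExponents m (Fin.last n)) := finite_reducedExponents.fintype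

/-- `A ⊗ S^{⊗n}` is the direct sum of the translates of the loop algebra by reduced monomials. -/
theorem bijective_sum_algebra (hm : ∀ p, 0 < m p) :
    Function.Bijective fun x : reducedExponents m (Fin.last n) → T.algebra =>
      ∑ a, (AddMonoidAlgebra.single a.1 1 : Laurent k n) • (x a : Untwisted k A n) := by
  obtain ⟨hind, htop⟩ := T.decomposition hm (Fin.last n)
  have := bijective_sum_map_of_iSupIndep
    (fun a : reducedExponents m (Fin.last n) => monomialMul_injective a.1) hind htop
  simp only [monomialMul_apply] at this
  exact this

end Tower
end Main
end LoopAlgebra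
end

/-- The `n`-step loop algebra `L` of any tower based on `M_ℓ(k)` is a prime Azumaya algebra of
constant rank `ℓ²` over its centroid `C(L)`. The extension `S^{⊗n}/C(L)` is the homomorphism
`ι : C(L) → S^{⊗n}` through which `C(L)` acts on `L ⊆ M_ℓ(k) ⊗ S^{⊗n}` (this property determines
`ι`), and it splits `L`. -/
theorem corollary7p4 {k : Type*} [Field k] {ℓ n : ℕ} (hℓ : 0 < ℓ) (m : Fin n → ℕ)
    (hm : ∀ p, 0 < m p)
    (T : LoopAlgebra.Tower k (Matrix (Fin ℓ) (Fin ℓ) k) n m) :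
    LoopAlgebra.IsPrimeAlgebra k T.algebra ∧
      IsAzumaya (LoopAlgebra.centroid k T.algebra) T.algebra ∧
      LoopAlgebra.HasConstantRank (LoopAlgebra.centroid k T.algebra) T.algebra (ℓ ^ 2) ∧
      ∃ ι : LoopAlgebra.centroid k T.algebra →ₐ[k] LoopAlgebra.Laurent k n,
        (∀ (χ : LoopAlgebra.centroid k T.algebra) (x : T.algebra),
          ι χ • (x : LoopAlgebra.Untwisted k (Matrix (Fin ℓ) (Fin ℓ) k) n) =
            (χ.1 x : LoopAlgebra.Untwisted k (Matrix (Fin ℓ) (Fin ℓ) k) n)) ∧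
        LoopAlgebra.IsSplitBy (LoopAlgebra.centroid k T.algebra) T.algebra
          (ι : LoopAlgebra.centroid k T.algebra →+* LoopAlgebra.Laurent k n) ℓ := by
  classical
  let e : LoopAlgebra.Untwisted k (Matrix (Fin ℓ) (Fin ℓ) k) n ≃ₐ[LoopAlgebra.Laurent k n]
      Matrix (Fin ℓ) (Fin ℓ) (LoopAlgebra.Laurent k n) :=
    LoopAlgebra.tensorMatrixEquiv k (LoopAlgebra.Laurent k n) ℓ
  have hs := T.bijective_sum_algebra hm
  have : Nonempty (Fin ℓ) := ⟨⟨0, hℓ⟩⟩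
  have : Algebra.IsCentral (LoopAlgebra.Laurent k n)
      (LoopAlgebra.Untwisted k (Matrix (Fin ℓ) (Fin ℓ) k) n) := .of_algEquiv _ _ _ e.symm
  have : FaithfulSMul (LoopAlgebra.Laurent k n)
      (LoopAlgebra.Untwisted k (Matrix (Fin ℓ) (Fin ℓ) k) n) := .of_injective e.symm e.symm.injective
  obtain ⟨υ, hυ⟩ := LoopAlgebra.exists_centroidScalar T.algebra hs
  obtain ⟨hAz, hrk, hsplit⟩ := LoopAlgebra.isAzumaya_and_isSplitBy T.algebra hs hυ
    -- The exponent `0` is reduced because the moduli are positive; its monomial is the basis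
    -- element `1`.
    (i₀ := ⟨0, fun p _ => ⟨le_rfl, Int.natCast_pos.2 (hm p)⟩⟩) AddMonoidAlgebra.one_def.symm hℓ e
  exact ⟨LoopAlgebra.isPrimeAlgebra_of_matrix T.algebra hs e, hAz, hrk, υ,
    LoopAlgebra.centroidScalar_smul T.algebra hυ, hsplit⟩
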